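/- Let $T_1,T_2$ be locally finite trees, and give each automorphism group $\mathrm{Aut}(T_i)$ the topology of pointwise convergence on vertices. For a subgroup $H<\mathrm{Aut}(T)$ and a vertex $x$ of $T$, let $\underline H(x)$ be the permutation group which the stabilizer of $x$ in $H$ induces on the set $E(x)$ of edges issued from $x$. Call $H$ locally quasi-primitive if, for every vertex $x$, the group $\underline H(x)$ is transitive on $E(x)$ and every non-trivial normal subgroup of $\underline H(x)$ is transitive on $E(x)$. Say that $H$ acts cocompactly on $T$ if it has finitely many orbits of vertices. For a closed subgroup $H<\mathrm{Aut}(T)$, let $H^{(\infty)}$ be the intersection of all open subgroups of finite index of $H$. For $i=1,2$, let $G_i<\mathrm{Aut}(T_i)$ be a non-discrete, locally quasi-primitive, closed subgroup acting cocompactly on $T_i$, such that $G_i^{(\infty)}$ has finite index in $G_i$. Let $L<G_1\times G_2$ be a closed subgroup such that $(G_1\times G_2)/L$ is compact and the projections of $L$ to $G_1$ and to $G_2$ are dense. Then $L$ is either discrete or open in $G_1\times G_2$; moreover, if $L$ is open, then it contains $G_1^{(\infty)}\times G_2^{(\infty)}$. -/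

import Mathlib

namespace TreeAut

universe u

variable {X : Type u}

/-- The topology of pointwise convergence on the automorphism group of a graph, the vertex set
being discrete (this is also the compact-open topology). -/
instance autTopology (T : SimpleGraph X) : TopologicalSpace (T ≃g T) :=
  TopologicalSpace.induced (fun (g : T ≃g T) (x : X) => g x)
    (@Pi.topologicalSpace X (fun _ => X) (fun _ => ⊥))

/-- The permutation group induced by the stabilizer in `H` of the vertex `x` on the set of edges
issued from `x`; such an edge is identified with its other end point, a neighbor of `x`. -/
def localGroup {T : SimpleGraph X} (H : Subgroup (T ≃g T)) (x : X) :
    Subgroup (Equiv.Perm (T.neighborSet x)) where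
  carrier := {σ | ∃ g ∈ H, g x = x ∧ ∀ y : T.neighborSet x, (σ y : X) = g (y : X)}
  one_mem' := ⟨1, H.one_mem, rfl, fun _ => rfl⟩
  mul_mem' := by
    rintro σ τ ⟨g, hg, hgx, hσ⟩ ⟨h, hh, hhx, hτ⟩
    refine ⟨g * h, H.mul_mem hg hh, ?_, fun y => ?_⟩
    · rw [RelIso.mul_apply, hhx, hgx]
    · rw [Equiv.Perm.mul_apply, hσ, hτ, RelIso.mul_apply]
  inv_mem' := by
    rintro σ ⟨g, hg, hgx, hσ⟩
    refine ⟨g⁻¹, H.inv_mem hg, ?_, fun y => ?_⟩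
    · conv_lhs => rw [← hgx]
      exact RelIso.inv_apply_self g x
    · have h := hσ (σ⁻¹ y)
      rw [← Equiv.Perm.mul_apply, mul_inv_cancel, Equiv.Perm.one_apply] at h
      rw [h, RelIso.inv_apply_self]

/-- `H` is locally quasi-primitive: for every vertex `x`, the permutation group induced on the
edges issued from `x` is transitive, and so is each of its non-trivial normal subgroups. (A permutation
group acts faithfully, so a normal subgroup is non-trivial if and only if it moves some point.) -/
def LocallyQuasiprimitive {T : SimpleGraph X} (H : Subgroup (T ≃g T)) : Prop :=
  ∀ x : X, MulAction.IsQuasiPreprimitive (localGroup H x) (T.neighborSet x)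

/-- `H` acts cocompactly on the (locally finite) graph: it has finitely many orbits of vertices. -/
def ActsCocompactly {T : SimpleGraph X} (H : Subgroup (T ≃g T)) : Prop :=
  Finite (MulAction.orbitRel.Quotient H X)

/-- `G^(∞)`: the intersection of all open subgroups of finite index of a topological group. -/
def residual (G : Type*) [Group G] [TopologicalSpace G] : Subgroup G :=
  sInf {K : Subgroup G | IsOpen (K : Set G) ∧ K.FiniteIndex}

end TreeAut

/-!
Let `N₁ = L ∩ G₁` and `N₂ = L ∩ G₂`. They are closed, and normal in `G₁` and `G₂` because the
projections of `L` are dense. In a locally quasi-primitive group, a normal subgroup acts freely on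
the vertices or has finitely many orbits of vertices (`TreeAut.actsFreely_or_finite_orbits`): at
each vertex its local action is trivial or transitive, and triviality at all vertices propagates
along paths. A closed normal subgroup with finitely many orbits is cocompact, hence an intersection
of open subgroups of finite index, hence contains `G^(∞)` (`TreeAut.residual_le_of_finite_orbits`).

* If `N₁ ⊇ G₁^(∞)` and `N₂ ⊇ G₂^(∞)`, then `L` contains the open subgroup `G₁^(∞) × G₂^(∞)`. This
  is the case whenever `L` is open: an open `Nᵢ` acting freely would make `Gᵢ` discrete.
* If `N₁` acts freely and `N₂ ⊇ G₂^(∞)` has finite index, then the projection of `L` to `G₁`, being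
  dense, shows that the closed subgroup `N₁` has finite index in `G₁`
  (`TreeAut.finiteIndex_comap_inl`). So `N₁` is open and `G₁` is discrete, a contradiction.
* If both act freely, then `L` is discrete (`TreeAut.discreteTopology_of_actsFreely`). Since `N₁`
  meets the stabilizer of `x` trivially, compactness gives a radius `n` such that the elements
  of `L` fixing `x` and the ball of radius `n` about `y` fix the neighbors of `x`. Since `L` has
  finitely many orbits of pairs `(x, y)`, one `n` serves all pairs. With `y` kept fixed, this spreads
  from `x` over the whole first tree, so that such an element lies in `N₂` and fixes `y`: it is
  trivial.
-/

open Filter Topology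

namespace TreeAut

universe v

variable {X : Type u} {T : SimpleGraph X}

/-! ### Balls in a locally finite connected graph -/

/-- In a connected graph, a property that passes from a vertex to its neighbors and holds at one
vertex holds everywhere. -/
theorem connected_induction (hT : T.Connected) {P : X → Prop} {x : X} (hx : P x)
    (h : ∀ u v, P u → T.Adj u v → P v) (z : X) : P z := by
  obtain ⟨p⟩ := hT.preconnected x z
  induction p with
  | nil => exact hx
  | cons hadj _ ih => exact ih (h _ _ hx hadj)

/-- The set of vertices joined to `y` by a walk of at most `n` edges. The recursive definition
makes finiteness and equivariance immediate. -/
def ball (T : SimpleGraph X) (y : X) : ℕ → Set X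
  | 0 => {y}
  | n + 1 => {z | z ∈ ball T y n ∨ ∃ w ∈ ball T y n, T.Adj w z}

theorem ball_mono (y : X) : Monotone (ball T y) :=
  monotone_nat_of_le_succ fun _ _ hz => Or.inl hz

theorem self_mem_ball (y : X) (n : ℕ) : y ∈ ball T y n :=
  ball_mono y (Nat.zero_le n) rfl

theorem finite_ball (hf : ∀ x, (T.neighborSet x).Finite) (y : X) (n : ℕ) :
    (ball T y n).Finite := by
  induction n with
  | zero => exact Set.finite_singleton y
  | succ n ih =>
    refine (ih.union (ih.biUnion fun w _ => hf w)).subset ?_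
    rintro z (hz | ⟨w, hw, hwz⟩)
    · exact Or.inl hz
    · exact Or.inr (Set.mem_biUnion hw hwz)

theorem apply_mem_ball (g : T ≃g T) {y z : X} {n : ℕ} (hz : z ∈ ball T y n) :
    g z ∈ ball T (g y) n := by
  induction n generalizing z with
  | zero => exact congrArg g hz
  | succ n ih =>
    rcases hz with hz | ⟨w, hw, hwz⟩
    · exact Or.inl (ih hz)
    · exact Or.inr ⟨g w, ih hw, g.map_adj_iff.2 hwz⟩

theorem exists_mem_ball (hT : T.Connected) (y z : X) : ∃ n, z ∈ ball T y n :=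
  connected_induction (P := fun z => ∃ n, z ∈ ball T y n) hT ⟨0, rfl⟩
    (fun u _ ⟨n, hn⟩ huv => ⟨n + 1, Or.inr ⟨u, hn, huv⟩⟩) z

/-! ### The topology of pointwise convergence -/

theorem continuous_of_isOpen_apply_eq {Z : Type v} [TopologicalSpace Z] {f : Z → (T ≃g T)}
    (h : ∀ x y, IsOpen {a | f a x = y}) : Continuous f := by
  let _ : TopologicalSpace X := ⊥
  have _ : DiscreteTopology X := ⟨rfl⟩
  refine continuous_induced_rng.2 (continuous_pi fun x => ?_)
  exact continuous_discrete_rng.2 fun y => h x y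

theorem isClopen_apply_eq (x y : X) : IsClopen {g : T ≃g T | g x = y} := by
  let _ : TopologicalSpace X := ⊥
  have _ : DiscreteTopology X := ⟨rfl⟩
  have h : Continuous fun (g : T ≃g T) => g x :=
    (continuous_apply x).comp (continuous_induced_dom (f := fun (g : T ≃g T) (x : X) => g x))
  exact (isClopen_discrete {y}).preimage h

theorem exists_finite_of_mem_nhds {g : T ≃g T} {V : Set (T ≃g T)} (hV : V ∈ 𝓝 g) :
    ∃ F : Set X, F.Finite ∧ ∀ h : T ≃g T, (∀ z ∈ F, h z = g z) → h ∈ V := by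
  let _ : TopologicalSpace X := ⊥
  obtain ⟨W, hW, hWV⟩ := (mem_nhds_induced (fun (g : T ≃g T) (x : X) => g x) g V).1 hV
  rw [nhds_pi, Filter.mem_pi] at hW
  obtain ⟨F, hF, t, ht, hFt⟩ := hW
  refine ⟨F, hF, fun h hh => hWV (hFt fun z hz => ?_)⟩
  change h z ∈ t z
  rw [hh z hz]
  exact mem_of_mem_nhds (ht z)

instance : IsTopologicalGroup (T ≃g T) where
  continuous_mul := by
    refine continuous_of_isOpen_apply_eq fun x y => ?_
    have : {a : (T ≃g T) × (T ≃g T) | (a.1 * a.2) x = y} =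
        ⋃ z, {g | g z = y} ×ˢ {h | h x = z} := by
      ext a
      simp [RelIso.mul_apply]
    exact this ▸ isOpen_iUnion fun z => (isClopen_apply_eq z y).isOpen.prod
      (isClopen_apply_eq x z).isOpen
  continuous_inv := by
    refine continuous_of_isOpen_apply_eq fun x y => ?_
    have : {a : T ≃g T | a⁻¹ x = y} = {a | a y = x} := by
      ext a
      constructor
      · rintro rfl
        exact RelIso.apply_inv_self a x
      · rintro rfl
        exact RelIso.inv_apply_self a y
    exact this ▸ (isClopen_apply_eq y x).isOpen

/-- The automorphisms that carry `x` to `y` form a compact set: along an ultrafilter, the image of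
each vertex is constant, because it stays in a finite ball about `y`, and the same holds for the
inverse images. -/
theorem isCompact_apply_eq (hT : T.Connected) (hf : ∀ x, (T.neighborSet x).Finite) (x y : X) :
    IsCompact {g : T ≃g T | g x = y} := by
  refine isCompact_iff_ultrafilter_le_nhds.2 fun U hU => ?_
  rw [le_principal_iff] at hU
  have hfwd : ∀ z, ∃ w, ∀ᶠ g : T ≃g T in U, g z = w := fun z => by
    obtain ⟨n, hn⟩ := exists_mem_ball hT x z
    obtain ⟨w, -, hw⟩ := (Ultrafilter.eventually_exists_mem_iff (finite_ball hf y n)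
      (P := fun w (g : T ≃g T) => g z = w)).1
      (by
        filter_upwards [hU] with g hg
        refine ⟨g z, ?_, rfl⟩
        have := apply_mem_ball g hn
        rwa [show g x = y from hg] at this)
    exact ⟨w, hw⟩
  have hbwd : ∀ z, ∃ w, ∀ᶠ g : T ≃g T in U, g w = z := fun z => by
    obtain ⟨n, hn⟩ := exists_mem_ball hT y z
    obtain ⟨w, -, hw⟩ := (Ultrafilter.eventually_exists_mem_iff (finite_ball hf x n)
      (P := fun w (g : T ≃g T) => g w = z)).1
      (by
        filter_upwards [hU] with g hg
        refine ⟨g⁻¹ z, ?_, RelIso.apply_inv_self g z⟩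
        have := apply_mem_ball g⁻¹ hn
        rwa [show g⁻¹ y = x from by
          rw [← show g x = y from hg]
          exact RelIso.inv_apply_self g x] at this)
    exact ⟨w, hw⟩
  choose a ha using hfwd
  choose b hb using hbwd
  have hab : ∀ z, a (b z) = z := fun z => by
    obtain ⟨g, h₁, h₂⟩ := ((ha (b z)).and (hb z)).exists
    exact h₁.symm.trans h₂
  have hba : ∀ z, b (a z) = z := fun z => by
    obtain ⟨g, h₁, h₂⟩ := ((ha z).and (hb (a z))).exists
    exact g.injective (h₂.trans h₁.symm)
  let g₀ : T ≃g T :=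
    { toFun := a
      invFun := b
      left_inv := hba
      right_inv := hab
      map_rel_iff' := fun {u v} => by
        obtain ⟨g, h₁, h₂⟩ := ((ha u).and (ha v)).exists
        change T.Adj (a u) (a v) ↔ _
        rw [← h₁, ← h₂]
        exact g.map_adj_iff }
  refine ⟨g₀, ?_, fun V hV => ?_⟩
  · obtain ⟨g, h₁, h₂⟩ := ((ha x).and hU).exists
    exact h₁.symm.trans h₂
  · obtain ⟨F, hF, hFV⟩ := exists_finite_of_mem_nhds hV
    filter_upwards [(eventually_all_finite hF).2 fun z _ => ha z] with g hg
    exact hFV g hg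

section Subgroup

variable {G : Subgroup (T ≃g T)}

theorem isClopen_subgroup_apply_eq (x y : X) : IsClopen {g : G | (g : T ≃g T) x = y} :=
  (isClopen_apply_eq x y).preimage continuous_subtype_val

theorem isCompact_subgroup_apply_eq (hT : T.Connected) (hf : ∀ x, (T.neighborSet x).Finite)
    (hcl : IsClosed (G : Set (T ≃g T))) (x y : X) : IsCompact {g : G | (g : T ≃g T) x = y} :=
  hcl.isClosedEmbedding_subtypeVal.isCompact_preimage (isCompact_apply_eq hT hf x y)

theorem isClopen_fixing {F : Set X} (hF : F.Finite) :
    IsClopen {g : G | ∀ z ∈ F, (g : T ≃g T) z = z} := by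
  have : {g : G | ∀ z ∈ F, (g : T ≃g T) z = z} = ⋂ z ∈ F, {g : G | (g : T ≃g T) z = z} := by
    ext g
    simp
  exact this ▸ hF.isClopen_biInter fun z _ => isClopen_subgroup_apply_eq z z

/-- The pointwise stabilizer in `G` of a set of vertices. -/
def fixing (G : Subgroup (T ≃g T)) (F : Set X) : Subgroup G where
  carrier := {g | ∀ z ∈ F, (g : T ≃g T) z = z}
  one_mem' _ _ := rfl
  mul_mem' := by
    intro g h hg hh z hz
    rw [Subgroup.coe_mul, RelIso.mul_apply, hh z hz, hg z hz]
  inv_mem' := by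
    intro g hg z hz
    conv_lhs => rw [← hg z hz]
    exact RelIso.inv_apply_self _ z

/-! ### Normal subgroups of locally quasi-primitive groups -/

/-- `N` acts freely on the vertices. -/
def ActsFreely (N : Subgroup G) : Prop :=
  ∀ n ∈ N, ∀ x, (n : T ≃g T) x = x → n = 1

theorem discreteTopology_of_isOpen_of_actsFreely (hT : T.Connected) {N : Subgroup G}
    (hN : IsOpen (N : Set G)) (h : ActsFreely N) : DiscreteTopology G := by
  obtain ⟨x⟩ := hT.nonempty
  refine discreteTopology_of_isOpen_singleton_one ?_
  convert hN.inter (isClopen_subgroup_apply_eq x x).isOpen using 1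
  ext g
  constructor
  · rintro rfl
    exact ⟨N.one_mem, rfl⟩
  · rintro ⟨hg, hgx⟩
    exact h g hg x hgx

/-- Local form of quasi-primitivity: at each vertex, the stabilizer in a normal subgroup either
fixes all neighbors or permutes them transitively. -/
theorem fixes_or_transitive_neighbors (hq : LocallyQuasiprimitive G) (N : Subgroup G) [N.Normal]
    (x : X) :
    (∀ n ∈ N, (n : T ≃g T) x = x → ∀ y, T.Adj x y → (n : T ≃g T) y = y) ∨
    (∀ y z, T.Adj x y → T.Adj x z → ∃ n ∈ N, (n : T ≃g T) x = x ∧ (n : T ≃g T) y = z) := by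
  let M : Subgroup (localGroup G x) := (localGroup (N.map G.subtype) x).subgroupOf (localGroup G x)
  have hM : M.Normal := by
    refine ⟨fun σ hσ τ => ?_⟩
    obtain ⟨_, ⟨n, hn, rfl⟩, hnx, hσn⟩ := hσ
    obtain ⟨g, hg, hgx, hτg⟩ := τ.2
    have hg' : g⁻¹ x = x := by
      conv_lhs => rw [← hgx]
      exact RelIso.inv_apply_self g x
    refine ⟨g * n * g⁻¹, ⟨⟨g, hg⟩ * n * ⟨g, hg⟩⁻¹, ‹N.Normal›.conj_mem n hn ⟨g, hg⟩, rfl⟩, ?_, ?_⟩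
    · change (n : T ≃g T) x = x at hnx
      simp only [RelIso.mul_apply, hg', hnx, hgx]
    · intro y
      have hinv : (((τ⁻¹ : localGroup G x) : Equiv.Perm (T.neighborSet x)) y : X) = g⁻¹ y := by
        have h := hτg ((τ⁻¹ : localGroup G x).1 y)
        rw [← Equiv.Perm.mul_apply] at h
        simp only [InvMemClass.coe_inv, mul_inv_cancel, Equiv.Perm.one_apply] at h
        rw [h, RelIso.inv_apply_self]
        rfl
      change ((τ.1 (σ.1 ((τ⁻¹ : localGroup G x).1 y)) : T.neighborSet x) : X) = _
      rw [hτg]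
      have h2 := hσn ((τ⁻¹ : localGroup G x).1 y)
      change ((σ.1 _ : T.neighborSet x) : X) = _ at h2
      rw [h2, hinv]
      rfl
  by_cases h : MulAction.fixedPoints M (T.neighborSet x) = Set.univ
  · left
    intro n hn hnx y hxy
    have hadj : ∀ (g : T ≃g T), g x = x → ∀ w, w ∈ T.neighborSet x ↔ g w ∈ T.neighborSet x := by
      intro g hg w
      have := g.map_adj_iff (v := x) (w := w)
      rw [hg] at this
      exact this.symm
    let σ : Equiv.Perm (T.neighborSet x) :=
      (n : T ≃g T).toEquiv.subtypeEquiv (hadj n hnx)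
    have hσG : σ ∈ localGroup G x := ⟨n, n.2, hnx, fun _ => rfl⟩
    have hσM : (⟨σ, hσG⟩ : localGroup G x) ∈ M := ⟨n, ⟨n, hn, rfl⟩, hnx, fun _ => rfl⟩
    have hy : (⟨y, hxy⟩ : T.neighborSet x) ∈ MulAction.fixedPoints M (T.neighborSet x) :=
      h ▸ Set.mem_univ _
    exact congrArg Subtype.val (hy ⟨_, hσM⟩)
  · right
    intro y z hy hz
    have := (hq x).isPretransitive_of_normal h
    obtain ⟨m, hm⟩ := MulAction.exists_smul_eq M (⟨y, hy⟩ : T.neighborSet x) ⟨z, hz⟩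
    obtain ⟨_, ⟨n, hn, rfl⟩, hnx, hmn⟩ := m.2
    exact ⟨n, hn, hnx, (hmn ⟨y, hy⟩).symm.trans (congrArg Subtype.val hm)⟩

theorem exists_apply_eq_of_adj (hq : LocallyQuasiprimitive G) {x y z : X} (hy : T.Adj x y)
    (hz : T.Adj x z) : ∃ g : G, (g : T ≃g T) y = z := by
  have := (hq x).toIsPretransitive
  obtain ⟨m, hm⟩ := MulAction.exists_smul_eq (localGroup G x) (⟨y, hy⟩ : T.neighborSet x) ⟨z, hz⟩
  obtain ⟨g, hg, -, hmg⟩ := m.2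
  exact ⟨⟨g, hg⟩, (hmg ⟨y, hy⟩).symm.trans (congrArg Subtype.val hm)⟩

/-- A normal subgroup of a locally quasi-primitive group acts freely on the vertices or has
finitely many orbits of vertices. In the second case, with `x` a vertex at which the local action
of `N` is transitive, the orbits are represented by a neighbor of `x` and its neighbors. -/
theorem actsFreely_or_finite_orbits (hT : T.Connected) (hf : ∀ x, (T.neighborSet x).Finite)
    (hq : LocallyQuasiprimitive G) (N : Subgroup G) [N.Normal] :
    ActsFreely N ∨ ∃ S : Set X, S.Finite ∧ ∀ x, ∃ n ∈ N, ∃ s ∈ S, (n : T ≃g T) s = x := by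
  by_cases hfix : ∀ x, ∀ n ∈ N, (n : T ≃g T) x = x → ∀ y, T.Adj x y → (n : T ≃g T) y = y
  · left
    intro n hn x hx
    refine Subtype.ext (RelIso.ext fun z => ?_)
    exact connected_induction (P := fun z => (n : T ≃g T) z = z) hT hx
      (fun u v hu huv => hfix u n hn hu v huv) z
  right
  obtain ⟨x, hx⟩ := not_forall.1 hfix
  have htr := (fixes_or_transitive_neighbors hq N x).resolve_left hx
  by_cases hy : ∃ y, T.Adj x y
  · obtain ⟨y, hxy⟩ := hy
    refine ⟨insert y (T.neighborSet y), (hf y).insert y, fun z => ?_⟩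
    refine connected_induction
      (P := fun z => ∃ n ∈ N, ∃ s ∈ insert y (T.neighborSet y), (n : T ≃g T) s = z) hT
      ⟨1, N.one_mem, y, Set.mem_insert _ _, rfl⟩ ?_ z
    rintro u v ⟨n, hn, s, hs, rfl⟩ huv
    obtain ⟨w, rfl⟩ := (n : T ≃g T).surjective v
    have hsw : T.Adj s w := (n : T ≃g T).map_adj_iff.1 huv
    rcases hs with rfl | hs
    · exact ⟨n, hn, w, Or.inr hsw, rfl⟩
    -- `s` is a translate of `x`, so the local action of `N` at `s` is transitive as well and
    -- moves `y` to the next neighbor `w` of `s`.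
    obtain ⟨g, rfl⟩ := exists_apply_eq_of_adj hq hxy.symm hs
    obtain ⟨a, rfl⟩ := (g : T ≃g T).surjective w
    obtain ⟨b, hb⟩ := (g : T ≃g T).surjective y
    have hxb : T.Adj x b := (g : T ≃g T).map_adj_iff.1 (hb ▸ SimpleGraph.Adj.symm hs)
    obtain ⟨m, hm, -, hmb⟩ := htr b a hxb ((g : T ≃g T).map_adj_iff.1 hsw)
    refine ⟨n * (g * m * g⁻¹), N.mul_mem hn (‹N.Normal›.conj_mem m hm g), y,
      Set.mem_insert _ _, ?_⟩
    have hgy : (g : T ≃g T)⁻¹ y = b := hb ▸ RelIso.inv_apply_self _ b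
    simp only [Subgroup.coe_mul, InvMemClass.coe_inv, RelIso.mul_apply, hgy, hmb]
  · refine ⟨{x}, Set.finite_singleton x, fun z => ⟨1, N.one_mem, x, rfl, ?_⟩⟩
    exact connected_induction (P := fun z => x = z) hT rfl
      (fun u v hu huv => (hy ⟨v, hu ▸ huv⟩).elim) z

/-- A closed normal subgroup `N` with finitely many orbits of vertices contains `G^(∞)`. Given
`g ∉ N`, some open subgroup `U` satisfies `g ∉ N U`, and `N U` is an open subgroup of finite index
because finitely many compact sets of automorphisms meet all its cosets. -/
theorem residual_le_of_finite_orbits (hT : T.Connected) (hf : ∀ x, (T.neighborSet x).Finite)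
    (hcl : IsClosed (G : Set (T ≃g T))) (N : Subgroup G) [N.Normal] (hN : IsClosed (N : Set G))
    (horb : ∃ S : Set X, S.Finite ∧ ∀ x, ∃ n ∈ N, ∃ s ∈ S, (n : T ≃g T) s = x) :
    residual G ≤ N := by
  intro g hg
  by_contra hgN
  have hV := hN.isOpen_compl.mem_nhds hgN
  rw [nhds_subtype_eq_comap] at hV
  obtain ⟨V, hV, hVN⟩ := Filter.mem_comap.1 hV
  obtain ⟨F, hF, hFV⟩ := exists_finite_of_mem_nhds hV
  have hWopen : IsOpen ((N ⊔ fixing G F : Subgroup G) : Set G) :=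
    Subgroup.isOpen_mono le_sup_right (isClopen_fixing hF).isOpen
  have hgW : g ∉ N ⊔ fixing G F := fun h => by
    rw [← SetLike.mem_coe, Subgroup.normal_mul] at h
    obtain ⟨n, hn, u, hu, rfl⟩ := h
    refine hVN (hFV n fun z hz => ?_) hn
    rw [Subgroup.coe_mul, RelIso.mul_apply, hu z hz]
  have hWfin : (N ⊔ fixing G F).FiniteIndex := by
    obtain ⟨x⟩ := hT.nonempty
    obtain ⟨S, hS, hSN⟩ := horb
    have _ : DiscreteTopology (G ⧸ (N ⊔ fixing G F)) := QuotientGroup.discreteTopology hWopen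
    have hcover : (Set.univ : Set (G ⧸ (N ⊔ fixing G F))) ⊆
        ⋃ s ∈ S, (QuotientGroup.mk '' {h : G | (h : T ≃g T) x = s}) := by
      rintro q -
      obtain ⟨h, rfl⟩ := QuotientGroup.mk_surjective q
      obtain ⟨n, hn, s, hs, hns⟩ := hSN ((h : T ≃g T) x)
      refine Set.mem_biUnion hs ⟨n⁻¹ * h, ?_, ?_⟩
      · change ((n⁻¹ * h : G) : T ≃g T) x = s
        rw [Subgroup.coe_mul, RelIso.mul_apply, ← hns]
        exact RelIso.inv_apply_self _ s
      · refine QuotientGroup.eq.2 (Subgroup.mem_sup_left ?_)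
        have := ‹N.Normal›.conj_mem n hn h⁻¹
        simpa [mul_assoc] using this
    have hfin : (Set.univ : Set (G ⧸ (N ⊔ fixing G F))).Finite :=
      (hS.biUnion fun s _ => ((isCompact_subgroup_apply_eq hT hf hcl x s).image
        QuotientGroup.continuous_mk).finite_of_discrete).subset hcover
    have _ := Set.finite_univ_iff.1 hfin
    exact Subgroup.finiteIndex_of_finite_quotient
  exact hgW (Subgroup.mem_sInf.1 hg _ ⟨hWopen, hWfin⟩)

theorem actsFreely_or_residual_le (hT : T.Connected) (hf : ∀ x, (T.neighborSet x).Finite)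
    (hq : LocallyQuasiprimitive G) (hcl : IsClosed (G : Set (T ≃g T))) (N : Subgroup G)
    [N.Normal] (hN : IsClosed (N : Set G)) : ActsFreely N ∨ residual G ≤ N :=
  (actsFreely_or_finite_orbits hT hf hq N).imp_right
    (residual_le_of_finite_orbits hT hf hcl N hN)

theorem isOpen_residual (hfi : (residual G).FiniteIndex) : IsOpen (residual G : Set G) := by
  refine Subgroup.isOpen_of_isClosed_of_finiteIndex _ ?_
  rw [residual, Subgroup.coe_sInf]
  exact isClosed_biInter fun K hK => K.isClosed_of_isOpen hK.1

end Subgroup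

/-! ### Subgroups of a product with dense projections -/

section Product

variable {A B : Type*} [Group A] [Group B] [TopologicalSpace A] [TopologicalSpace B]
  {L : Subgroup (A × B)}

theorem isClosed_comap_inl (hL : IsClosed (L : Set (A × B))) :
    IsClosed (L.comap (MonoidHom.inl A B) : Set A) :=
  hL.preimage (by fun_prop : Continuous fun a : A => (a, (1 : B)))

/-- The projection of `L` normalizes `L ∩ A`, and so does its closure. -/
theorem normal_comap_inl [IsTopologicalGroup A] (hL : IsClosed (L : Set (A × B)))
    (hd : Dense (Prod.fst '' (L : Set (A × B)))) : (L.comap (MonoidHom.inl A B)).Normal := by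
  refine ⟨fun n hn g => ?_⟩
  have hcl : IsClosed {g : A | g * n * g⁻¹ ∈ (L.comap (MonoidHom.inl A B) : Set A)} :=
    (isClosed_comap_inl hL).preimage (by fun_prop)
  refine hcl.closure_subset_iff.2 ?_ (hd g)
  rintro _ ⟨l, hl, rfl⟩
  have := L.mul_mem (L.mul_mem hl hn) (L.inv_mem hl)
  simpa [Subgroup.mem_comap, Prod.mul_def] using this

/-- If `L ∩ B` has finite index in `B`, the projection of `L` to `A` lies in a finite union of
cosets of the closed subgroup `L ∩ A`; being dense, it meets all cosets. -/
theorem finiteIndex_comap_inl [IsTopologicalGroup A] (hL : IsClosed (L : Set (A × B)))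
    (hd : Dense (Prod.fst '' (L : Set (A × B))))
    (h : (L.comap (MonoidHom.inr A B)).FiniteIndex) :
    (L.comap (MonoidHom.inl A B)).FiniteIndex := by
  have key : ∀ q : B ⧸ L.comap (MonoidHom.inr A B), ∃ a : A, ∀ l ∈ L,
      (QuotientGroup.mk l.2 : B ⧸ L.comap (MonoidHom.inr A B)) = q →
        a⁻¹ * l.1 ∈ L.comap (MonoidHom.inl A B) := by
    intro q
    by_cases hq : ∃ m ∈ L, (QuotientGroup.mk m.2 : B ⧸ L.comap (MonoidHom.inr A B)) = q
    · obtain ⟨m, hm, rfl⟩ := hq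
      refine ⟨m.1, fun l hl hlm => ?_⟩
      have h1 : ((1 : A), m.2⁻¹ * l.2) ∈ L := QuotientGroup.eq.1 hlm.symm
      have h2 := L.mul_mem (L.mul_mem (L.inv_mem hm) hl) (L.inv_mem h1)
      simpa [Subgroup.mem_comap, Prod.mul_def] using h2
    · exact ⟨1, fun l hl hlq => (hq ⟨l, hl, hlq⟩).elim⟩
  choose a ha using key
  have hcl : IsClosed (⋃ q, {b : A | (a q)⁻¹ * b ∈ (L.comap (MonoidHom.inl A B) : Set A)}) :=
    isClosed_iUnion_of_finite fun q => (isClosed_comap_inl hL).preimage (by fun_prop)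
  have hsub : Prod.fst '' (L : Set (A × B)) ⊆
      ⋃ q, {b : A | (a q)⁻¹ * b ∈ (L.comap (MonoidHom.inl A B) : Set A)} := by
    rintro _ ⟨l, hl, rfl⟩
    exact Set.mem_iUnion.2 ⟨QuotientGroup.mk l.2, ha _ l hl rfl⟩
  have _ : Finite (A ⧸ L.comap (MonoidHom.inl A B)) := by
    refine Finite.of_surjective
      (fun q => (QuotientGroup.mk (a q) : A ⧸ L.comap (MonoidHom.inl A B))) fun c => ?_
    obtain ⟨b, rfl⟩ := QuotientGroup.mk_surjective c
    obtain ⟨q, hq⟩ := Set.mem_iUnion.1 (hcl.closure_subset_iff.2 hsub (hd b))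
    exact ⟨q, QuotientGroup.eq.2 hq⟩
  exact Subgroup.finiteIndex_of_finite_quotient

end Product

/-! ### Subgroups that intersect both factors freely -/

theorem ActsCocompactly.exists_finite {G : Subgroup (T ≃g T)} (h : ActsCocompactly G) :
    ∃ S : Set X, S.Finite ∧ ∀ x, ∃ g : G, ∃ s ∈ S, (g : T ≃g T) s = x := by
  have _ : Finite (MulAction.orbitRel.Quotient G X) := h
  refine ⟨Set.range (Quotient.out : MulAction.orbitRel.Quotient G X → X), Set.finite_range _,
    fun x => ?_⟩
  have hx : (MulAction.orbitRel G X) x (Quotient.mk (MulAction.orbitRel G X) x).out :=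
    (MulAction.orbitRel G X).symm (Quotient.mk_out (s := MulAction.orbitRel G X) x)
  obtain ⟨g, hg⟩ := hx
  exact ⟨g, _, ⟨_, rfl⟩, hg⟩

section Pair

universe w

variable {Y : Type w} {R : SimpleGraph Y} {G : Subgroup (T ≃g T)} {H : Subgroup (R ≃g R)}
  {L : Subgroup (G × H)}

/-- A cocompact subgroup of `G × H` has finitely many orbits in each `G × H`-orbit: its orbits in
the orbit of `(x, y)` correspond to the members of an open partition of `(G × H) ⧸ L`. -/
theorem exists_finite_of_compactSpace_quotient (hL : CompactSpace ((G × H) ⧸ L)) (x : X) (y : Y) :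
    ∃ S : Set (X × Y), S.Finite ∧ ∀ g : G × H, ∃ l ∈ L, ∃ s ∈ S,
      (l.1 : T ≃g T) s.1 = (g.1 : T ≃g T) x ∧ (l.2 : R ≃g R) s.2 = (g.2 : R ≃g R) y := by
  let O : X × Y → Set (G × H) := fun s =>
    {a | ∃ l ∈ L, (a.1 : T ≃g T) ((l.1 : T ≃g T) s.1) = x ∧
      (a.2 : R ≃g R) ((l.2 : R ≃g R) s.2) = y}
  have hO : ∀ s, IsOpen (O s) := fun s => by
    have : O s = ⋃ l ∈ L, {g : G | (g : T ≃g T) ((l.1 : T ≃g T) s.1) = x} ×ˢ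
        {h : H | (h : R ≃g R) ((l.2 : R ≃g R) s.2) = y} := by
      ext a
      simp only [O, Set.mem_ofPred_eq, Set.mem_iUnion, Set.mem_prod, exists_prop]
    exact this ▸ isOpen_biUnion fun l _ => (isClopen_subgroup_apply_eq _ _).isOpen.prod
      (isClopen_subgroup_apply_eq _ _).isOpen
  obtain ⟨S, hS⟩ := isCompact_univ.elim_finite_subcover
    (fun s => (QuotientGroup.mk '' O s : Set ((G × H) ⧸ L)))
    (fun s => QuotientGroup.isOpenMap_coe _ (hO s)) (by
      rintro q -
      obtain ⟨a, rfl⟩ := QuotientGroup.mk_surjective q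
      exact Set.mem_iUnion.2 ⟨((a.1 : T ≃g T)⁻¹ x, (a.2 : R ≃g R)⁻¹ y), a,
        ⟨1, L.one_mem, RelIso.apply_inv_self _ x, RelIso.apply_inv_self _ y⟩, rfl⟩)
  refine ⟨S, S.finite_toSet, fun g => ?_⟩
  obtain ⟨s, hs, b, ⟨l, hl, h1, h2⟩, hb⟩ := Set.mem_iUnion₂.1
    (hS (Set.mem_univ (QuotientGroup.mk g⁻¹)))
  have hgb : g * b ∈ L := by
    have := L.inv_mem (QuotientGroup.eq.1 hb)
    simpa using this
  refine ⟨g * b * l, L.mul_mem hgb hl, s, hs, ?_, ?_⟩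
  · rw [← h1]
    rfl
  · rw [← h2]
    rfl

theorem exists_finite_orbits_prod (hL : CompactSpace ((G × H) ⧸ L)) (hG : ActsCocompactly G)
    (hH : ActsCocompactly H) :
    ∃ S : Set (X × Y), S.Finite ∧ ∀ x y, ∃ l ∈ L, ∃ s ∈ S,
      (l.1 : T ≃g T) s.1 = x ∧ (l.2 : R ≃g R) s.2 = y := by
  obtain ⟨S₁, hS₁, h₁⟩ := hG.exists_finite
  obtain ⟨S₂, hS₂, h₂⟩ := hH.exists_finite
  choose S hS h using fun p : X × Y => exists_finite_of_compactSpace_quotient hL p.1 p.2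
  refine ⟨⋃ p ∈ S₁ ×ˢ S₂, S p, (hS₁.prod hS₂).biUnion fun p _ => hS p, fun x y => ?_⟩
  obtain ⟨g, s₁, hs₁, rfl⟩ := h₁ x
  obtain ⟨g', s₂, hs₂, rfl⟩ := h₂ y
  obtain ⟨l, hl, s, hs, hls⟩ := h (s₁, s₂) (g, g')
  exact ⟨l, hl, s, Set.mem_biUnion (Set.mk_mem_prod hs₁ hs₂) hs, hls⟩

/-- The elements of `L` that fix `x` and the ball of radius `n` about `y` fix all neighbors
of `x`. -/
def FixesNeighbors (L : Subgroup (G × H)) (x : X) (y : Y) (n : ℕ) : Prop :=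
  ∀ l ∈ L, (l.1 : T ≃g T) x = x → (∀ z ∈ ball R y n, (l.2 : R ≃g R) z = z) →
    ∀ w, T.Adj x w → (l.1 : T ≃g T) w = w

theorem FixesNeighbors.mono {x : X} {y : Y} {m n : ℕ} (h : FixesNeighbors L x y m) (hmn : m ≤ n) :
    FixesNeighbors L x y n :=
  fun l hl hx hy => h l hl hx fun z hz => hy z (ball_mono y hmn hz)

theorem FixesNeighbors.apply {x : X} {y : Y} {n : ℕ} (h : FixesNeighbors L x y n) {l : G × H}
    (hl : l ∈ L) : FixesNeighbors L ((l.1 : T ≃g T) x) ((l.2 : R ≃g R) y) n := by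
  intro m hm hmx hmy w hw
  obtain ⟨w, rfl⟩ := (l.1 : T ≃g T).surjective w
  have h1 := h (l⁻¹ * m * l) (L.mul_mem (L.mul_mem (L.inv_mem hl) hm) hl)
    ((congrArg ((l.1 : T ≃g T)⁻¹ : T ≃g T) hmx).trans (RelIso.inv_apply_self _ x))
    (fun z hz => (congrArg ((l.2 : R ≃g R)⁻¹ : R ≃g R) (hmy _ (apply_mem_ball _ hz))).trans
      (RelIso.inv_apply_self _ z)) w ((l.1 : T ≃g T).map_adj_iff.1 hw)
  have h2 := congrArg (l.1 : T ≃g T) h1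
  exact (RelIso.apply_inv_self (l.1 : T ≃g T) _).symm.trans h2

/-- Otherwise, by compactness of the stabilizer of `(x, y)`, some element of `L` would act
trivially on `R`, fix `x`, and move a neighbor of `x`. -/
theorem exists_fixesNeighbors (hT : T.Connected) (hR : R.Connected)
    (hfT : ∀ x, (T.neighborSet x).Finite) (hfR : ∀ y, (R.neighborSet y).Finite)
    (hG : IsClosed (G : Set (T ≃g T))) (hH : IsClosed (H : Set (R ≃g R)))
    (hL : IsClosed (L : Set (G × H))) (h₁ : ActsFreely (L.comap (MonoidHom.inl G H)))
    (x : X) (y : Y) : ∃ n, FixesNeighbors L x y n := by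
  by_contra hcon
  let C : ℕ → Set (G × H) := fun n => (L : Set (G × H)) ∩
    ({g : G | (g : T ≃g T) x = x} ∩ {g : G | ∀ z ∈ T.neighborSet x, (g : T ≃g T) z = z}ᶜ) ×ˢ
      ({h : H | (h : R ≃g R) y = y} ∩ {h : H | ∀ z ∈ ball R y n, (h : R ≃g R) z = z})
  have hcl : ∀ n, IsClosed (C n) := fun n => hL.inter
    (((isClopen_subgroup_apply_eq x x).inter (isClopen_fixing (hfT x)).compl).isClosed.prod
      ((isClopen_subgroup_apply_eq y y).inter (isClopen_fixing (finite_ball hfR y n))).isClosed)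
  have hcpt : IsCompact (C 0) :=
    ((isCompact_subgroup_apply_eq hT hfT hG x x).prod
      (isCompact_subgroup_apply_eq hR hfR hH y y)).of_isClosed_subset (hcl 0)
      (Set.inter_subset_right.trans (Set.prod_mono Set.inter_subset_left Set.inter_subset_left))
  have hanti : ∀ n, C (n + 1) ⊆ C n := fun n l hl =>
    ⟨hl.1, hl.2.1, hl.2.2.1, fun z hz => hl.2.2.2 z (ball_mono y n.le_succ hz)⟩
  have hne : ∀ n, (C n).Nonempty := fun n => by
    have hn := not_exists.1 hcon n
    simp only [FixesNeighbors, not_forall] at hn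
    obtain ⟨l, hl, hlx, hly, w, hw, hlw⟩ := hn
    exact ⟨l, hl, ⟨hlx, fun h => hlw (h w hw)⟩, hly y (self_mem_ball y n), hly⟩
  obtain ⟨l, hl⟩ := IsCompact.nonempty_iInter_of_sequence_nonempty_isCompact_isClosed C hanti hne
    hcpt hcl
  rw [Set.mem_iInter] at hl
  have hl2 : l.2 = 1 := Subtype.ext (RelIso.ext fun z => by
    obtain ⟨n, hn⟩ := exists_mem_ball hR y z
    exact (hl n).2.2.2 z hn)
  have hl1 : l.1 = 1 := by
    refine h₁ l.1 ?_ x (hl 0).2.1.1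
    have : (l.1, (1 : H)) = l := Prod.ext rfl hl2.symm
    change (l.1, (1 : H)) ∈ L
    exact this ▸ (hl 0).1
  exact (hl 0).2.1.2 fun z _ => by rw [hl1]; rfl

/-- By cocompactness there is a radius `n` that serves all pairs `(x, y)`. An element of `L` that
fixes one vertex `x` and one ball of radius `n` then fixes the neighbors of `x`, their neighbors,
and so on, hence acts trivially on `T`. -/
theorem discreteTopology_of_actsFreely (hT : T.Connected) (hR : R.Connected)
    (hfT : ∀ x, (T.neighborSet x).Finite) (hfR : ∀ y, (R.neighborSet y).Finite)
    (hG : IsClosed (G : Set (T ≃g T))) (hH : IsClosed (H : Set (R ≃g R)))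
    (hcoG : ActsCocompactly G) (hcoH : ActsCocompactly H)
    (hL : IsClosed (L : Set (G × H))) (hco : CompactSpace ((G × H) ⧸ L))
    (h₁ : ActsFreely (L.comap (MonoidHom.inl G H)))
    (h₂ : ActsFreely (L.comap (MonoidHom.inr G H))) : DiscreteTopology L := by
  obtain ⟨S, hS, hSL⟩ := exists_finite_orbits_prod hco hcoG hcoH
  choose r hr using fun s : X × Y => exists_fixesNeighbors hT hR hfT hfR hG hH hL h₁ s.1 s.2
  obtain ⟨n, hn⟩ := (hS.image r).bddAbove
  have hall : ∀ x y, FixesNeighbors L x y n := by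
    intro x y
    obtain ⟨l, hl, s, hs, rfl, rfl⟩ := hSL x y
    exact ((hr s).mono (hn (Set.mem_image_of_mem r hs))).apply hl
  obtain ⟨x⟩ := hT.nonempty
  obtain ⟨y⟩ := hR.nonempty
  refine discreteTopology_of_isOpen_singleton_one ?_
  have hopen : IsOpen {l : L | (l.1.1 : T ≃g T) x = x ∧
      ∀ z ∈ ball R y n, (l.1.2 : R ≃g R) z = z} :=
    ((isClopen_subgroup_apply_eq x x).isOpen.prod
      (isClopen_fixing (finite_ball hfR y n)).isOpen).preimage continuous_subtype_val
  convert hopen using 1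
  ext l
  constructor
  · rintro rfl
    exact ⟨rfl, fun _ _ => rfl⟩
  rintro ⟨hx, hy⟩
  have hl1 : l.1.1 = 1 := Subtype.ext (RelIso.ext fun z =>
    connected_induction (P := fun z => (l.1.1 : T ≃g T) z = z) hT hx
      (fun u v hu huv => hall u y l.1 l.2 hu hy v huv) z)
  have hl2 : l.1.2 = 1 := by
    refine h₂ l.1.2 ?_ y (hy y (self_mem_ball y n))
    have : ((1 : G), l.1.2) = l.1 := Prod.ext hl1.symm rfl
    change ((1 : G), l.1.2) ∈ L
    exact this ▸ l.2
  exact Subtype.ext (Prod.ext hl1 hl2)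

end Pair

end TreeAut

theorem proposition2p2
    {X₁ : Type*} {X₂ : Type*} (T₁ : SimpleGraph X₁) (T₂ : SimpleGraph X₂)
    (hT₁ : T₁.IsTree) (hT₂ : T₂.IsTree)
    (hf₁ : ∀ x, (T₁.neighborSet x).Finite) (hf₂ : ∀ x, (T₂.neighborSet x).Finite)
    (G₁ : Subgroup (T₁ ≃g T₁)) (G₂ : Subgroup (T₂ ≃g T₂))
    (hnd₁ : ¬ DiscreteTopology G₁) (hnd₂ : ¬ DiscreteTopology G₂)
    (hq₁ : TreeAut.LocallyQuasiprimitive G₁) (hq₂ : TreeAut.LocallyQuasiprimitive G₂)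
    (hcl₁ : IsClosed (G₁ : Set (T₁ ≃g T₁))) (hcl₂ : IsClosed (G₂ : Set (T₂ ≃g T₂)))
    (hco₁ : TreeAut.ActsCocompactly G₁) (hco₂ : TreeAut.ActsCocompactly G₂)
    (hfi₁ : (TreeAut.residual G₁).FiniteIndex) (hfi₂ : (TreeAut.residual G₂).FiniteIndex)
    (L : Subgroup (G₁ × G₂)) (hLcl : IsClosed (L : Set (G₁ × G₂)))
    (hLco : CompactSpace ((G₁ × G₂) ⧸ L))
    (hd₁ : Dense (Prod.fst '' (L : Set (G₁ × G₂))))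
    (hd₂ : Dense (Prod.snd '' (L : Set (G₁ × G₂)))) :
    (DiscreteTopology L ∨ IsOpen (L : Set (G₁ × G₂))) ∧
      (IsOpen (L : Set (G₁ × G₂)) →
        (TreeAut.residual G₁).prod (TreeAut.residual G₂) ≤ L) := by
  have hc₁ := hT₁.connected
  have hc₂ := hT₂.connected
  -- The arguments about `L ∩ G₁` apply to `L ∩ G₂` after exchange of the two factors.
  let L' : Subgroup (G₂ × G₁) := L.comap (MulEquiv.prodComm : G₂ × G₁ ≃* G₁ × G₂).toMonoidHom
  have hL' : IsClosed (L' : Set (G₂ × G₁)) := hLcl.preimage continuous_swap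
  have hd' : Dense (Prod.fst '' (L' : Set (G₂ × G₁))) := by
    convert hd₂ using 1
    ext a
    constructor
    · rintro ⟨l, hl, rfl⟩
      exact ⟨l.swap, hl, rfl⟩
    · rintro ⟨l, hl, rfl⟩
      exact ⟨l.swap, hl, rfl⟩
  let N₁ : Subgroup G₁ := L.comap (MonoidHom.inl G₁ G₂)
  let N₂ : Subgroup G₂ := L.comap (MonoidHom.inr G₁ G₂)
  have hN₁ : IsClosed (N₁ : Set G₁) := TreeAut.isClosed_comap_inl hLcl
  have hN₂ : IsClosed (N₂ : Set G₂) := TreeAut.isClosed_comap_inl hL'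
  have _ : N₁.Normal := TreeAut.normal_comap_inl hLcl hd₁
  have _ : N₂.Normal := TreeAut.normal_comap_inl hL' hd'
  have hfree₁ : IsOpen (N₁ : Set G₁) → ¬ TreeAut.ActsFreely N₁ := fun h h' =>
    hnd₁ (TreeAut.discreteTopology_of_isOpen_of_actsFreely hc₁ h h')
  have hfree₂ : IsOpen (N₂ : Set G₂) → ¬ TreeAut.ActsFreely N₂ := fun h h' =>
    hnd₂ (TreeAut.discreteTopology_of_isOpen_of_actsFreely hc₂ h h')
  have hle : TreeAut.residual G₁ ≤ N₁ → TreeAut.residual G₂ ≤ N₂ →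
      (TreeAut.residual G₁).prod (TreeAut.residual G₂) ≤ L := fun h₁ h₂ l hl => by
    have := L.mul_mem (h₁ hl.1) (h₂ hl.2)
    simpa using this
  have hdich₁ := TreeAut.actsFreely_or_residual_le hc₁ hf₁ hq₁ hcl₁ N₁ hN₁
  have hdich₂ := TreeAut.actsFreely_or_residual_le hc₂ hf₂ hq₂ hcl₂ N₂ hN₂
  refine ⟨?_, fun hopen => ?_⟩
  · rcases hdich₁ with h₁ | h₁ <;> rcases hdich₂ with h₂ | h₂
    · exact Or.inl (TreeAut.discreteTopology_of_actsFreely hc₁ hc₂ hf₁ hf₂ hcl₁ hcl₂ hco₁ hco₂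
        hLcl hLco h₁ h₂)
    · have hfin : N₁.FiniteIndex :=
        TreeAut.finiteIndex_comap_inl hLcl hd₁ (Subgroup.finiteIndex_of_le h₂)
      exact (hfree₁ (N₁.isOpen_of_isClosed_of_finiteIndex hN₁) h₁).elim
    · have hfin : N₂.FiniteIndex :=
        TreeAut.finiteIndex_comap_inl hL' hd'
          (Subgroup.finiteIndex_of_le (H := TreeAut.residual G₁) h₁)
      exact (hfree₂ (N₂.isOpen_of_isClosed_of_finiteIndex hN₂) h₂).elim
    · refine Or.inr (Subgroup.isOpen_mono (hle h₁ h₂) ?_)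
      exact (TreeAut.isOpen_residual hfi₁).prod (TreeAut.isOpen_residual hfi₂)
  · have hcont₁ : Continuous fun g : G₁ => (g, (1 : G₂)) := by fun_prop
    have hcont₂ : Continuous fun g : G₂ => ((1 : G₁), g) := by fun_prop
    exact hle (hdich₁.resolve_left (hfree₁ (hopen.preimage hcont₁)))
      (hdich₂.resolve_left (hfree₂ (hopen.preimage hcont₂)))
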